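/- Let $I$ (actions of Player 1) and $S$ (signals) be finite nonempty sets, let $\Delta(I)$, $\Delta(S)$ be the sets of probabilities on them, and call the elements of $\Delta(S)^I$ flags. All norms are Euclidean. Let $G:\Delta(I)\times\Delta(S)^I\to\mathbb R$ be an arbitrary function, and for $\varepsilon>0$ put $BR_\varepsilon(\mu)=\{x\in\Delta(I): G(x,\mu)\ge \sup_{z\in\Delta(I)}G(z,\mu)-\varepsilon\}$. For a finite index set $L$, families $\mu(l)\in\Delta(S)^I$, $x(l)\in\Delta(I)$ ($l\in L$) and $\eta,\delta>0$ are called regular at level $\varepsilon$ if (1) every flag is at distance at most $\delta$ from some $\mu(l)$, and (2) for every $l\in L$, if $\|x-x(l)\|\le 2\eta$ and $\|\mu-\mu(l)\|\le 2\delta$ then $x\in BR_\varepsilon(\mu)$. Assumption 1 on $G$ is: for every $\varepsilon>0$ there exist families and radii that are regular at level $\varepsilon$. Game. Let $L$ be a finite set and $y(l)\in\Delta(I)$, $l\in L$. At each stage $n=1,2,\dots$, Player 2 chooses a flag $\mu_n$ and Player 1 chooses a type $l_n\in L$, independently given the past; then $i_n\in I$ is drawn according to $y(l_n)$, and Player 1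 receives a signal $s_n$ of law $\mu_n^{i_n}$, conditionally on everything else. A strategy $\sigma$ of Player 1 gives the law of $l_n$ as a function of $(l_m,i_m,s_m)_{m<n}$; a strategy $\tau$ of Player 2 gives the law of $\mu_n$ as a measurable function of $(\mu_m,l_m,i_m,s_m)_{m<n}$. Let $\mathbb P_{\sigma,\tau}$ be the law of the play, let $N_n(l)=\{m\le n: l_m=l\}$, and let $\overline\mu_n(l)$, $\overline\imath_n(l)$ and $\widetilde s_n(l)$ be the averages over $N_n(l)$ of the flags $\mu_m$, of the unit vectors $e_{i_m}\in\mathbb R^I$, and of the vectors $\widehat s_m=\big(\mathbf 1\{i_m=i\}\mathbf 1\{s_m=s\}/y(l_m)[i_m]\big)_{i,s}\in\mathbb R^{I\times S}$. Put $\mathcal R_n(l)=\sup_{x\in\Delta(I)}\big[G(x,\overline\mu_n(l))-G(\overline\imath_n(l),\overline\mu_n(l))\big]$. The strategy $\sigma$ (with the family $y$) is $(L,\varepsilon)$-internally consistent if for every strategy $\tau$ of Player 2, $\mathbb P_{\sigma,\tau}$-almost surely, for every $l\in L$, $$\limsup_{n\to\infty}\frac{|N_n(l)|}{n}\big(\mathcal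 R_n(l)-\varepsilon\big)\le 0 .$$ Theorem. Suppose that $G$ satisfies Assumption 1. Then for every $\varepsilon>0$ there exists an $(L,\varepsilon)$-internally consistent strategy. More precisely, there exist families $\mu(l),x(l)$, $l\in L$, and radii $\eta,\delta>0$ with $\eta\le 1$ that are regular at level $\varepsilon$, and a strategy $\sigma$ of Player 1 with types $L$ that plays $y(l)=(1-\eta)x(l)+\eta\mathbf u$ ($\mathbf u$ the uniform probability on $I$) at the stages of type $l$, such that $\sigma$ is $(L,\varepsilon)$-internally consistent and is calibrated with respect to $\{\mu(l)\}$ on the estimates $\widehat s_n$: for every strategy $\tau$ of Player 2, $\mathbb P_{\sigma,\tau}$-almost surely, for all $l,k\in L$, $$\limsup_{n\to\infty}\frac{|N_n(l)|}{n}\Big(\|\widetilde s_n(l)-\mu(l)\|^2-\|\widetilde s_n(l)-\mu(k)\|^2\Big)\le 0 .$$ -/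

import Mathlib

open MeasureTheory ProbabilityTheory Filter

noncomputable section

namespace PartialMonitoring

/-! ### Flags, norms, best responses -/

/-- A flag: an element of `Δ(S)^I`, i.e. one law on the signals `S` for each action in `I`. -/
abbrev Flag (I S : Type*) [Fintype S] : Type _ := I → stdSimplex ℝ S

/-- A flag seen as a vector of `ℝ^{IS}`. -/
def Flag.vec {I S : Type*} [Fintype S] (μ : Flag I S) : I → S → ℝ := fun i s => μ i s

/-- The Euclidean norm on `ℝ^A`. -/
def norm2 {A : Type*} [Fintype A] (v : A → ℝ) : ℝ := √(∑ a, v a ^ 2)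

/-- The Euclidean distance on `ℝ^{IS}`. -/
def flagDist {I S : Type*} [Fintype I] [Fintype S] (u v : I → S → ℝ) : ℝ :=
  norm2 (fun p : I × S => u p.1 p.2 - v p.1 p.2)

/-- `x ∈ BR_ε(μ)`: the mixed action `x` satisfies `G(x, μ) ≥ sup_{z ∈ Δ(I)} G(z, μ) - ε`
(in particular the supremum is finite).

The evaluation function `G` is a function on `Δ(I) × Δ(S)^I`; it is written as a function on the
ambient spaces `ℝ^I` and `ℝ^{IS}`, and its values elsewhere play no role. -/
def IsBestResponse {I S : Type*} [Fintype I] (G : (I → ℝ) → (I → S → ℝ) → ℝ)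
    (ε : ℝ) (μ : I → S → ℝ) (x : I → ℝ) : Prop :=
  ∀ z : stdSimplex ℝ I, G z μ - ε ≤ G x μ

/-- The finite families `μ(l) ∈ Δ(S)^I`, `x(l) ∈ Δ(I)` are regular for `G` at level `ε` with
radii `η, δ > 0`: the balls `B(μ(l), δ)` cover `Δ(S)^I`, and every `x` that is `2η`-close to `x(l)`
is an `ε`-best response to every flag that is `2δ`-close to `μ(l)`. -/
structure IsRegularFamily {L I S : Type*} [Fintype I] [Fintype S]
    (G : (I → ℝ) → (I → S → ℝ) → ℝ) (ε : ℝ)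
    (μ : L → Flag I S) (x : L → stdSimplex ℝ I) (η δ : ℝ) : Prop where
  eta_pos : 0 < η
  delta_pos : 0 < δ
  cover : ∀ ν : Flag I S, ∃ l, flagDist ν.vec (μ l).vec ≤ δ
  response : ∀ (l : L) (x' : stdSimplex ℝ I) (ν : Flag I S),
    norm2 (fun i => x' i - x l i) ≤ 2 * η → flagDist ν.vec (μ l).vec ≤ 2 * δ →
      IsBestResponse G ε ν.vec x'

/-- The regularity assumption on the evaluation function: regular families exist at each level. -/
def RegularEvaluation {I S : Type*} [Fintype I] [Fintype S]
    (G : (I → ℝ) → (I → S → ℝ) → ℝ) : Prop :=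
  ∀ ε : ℝ, 0 < ε → ∃ (K : ℕ) (μ : Fin K → Flag I S) (x : Fin K → stdSimplex ℝ I) (η δ : ℝ),
    IsRegularFamily G ε μ x η δ

/-! ### The repeated game -/

/-- What happens at one stage: the flag `μ_n` chosen by Player 2, the type `l_n` chosen by
Player 1, the action `i_n` and the signal `s_n`. -/
abbrev Stage (L I S : Type*) [Fintype S] : Type _ := Flag I S × L × I × S

namespace Stage

variable {L I S : Type*} [Fintype S]

/-- The flag of a stage. -/
def flag (w : Stage L I S) : Flag I S := w.1

/-- The type of a stage. -/
def type (w : Stage L I S) : L := w.2.1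

/-- The action of Player 1 at a stage. -/
def action (w : Stage L I S) : I := w.2.2.1

/-- The signal received by Player 1 at a stage. -/
def signal (w : Stage L I S) : S := w.2.2.2

end Stage

/-- A strategy of Player 1: given what he has observed in the first `n` stages (his types, his
actions and his signals), it returns the law of the type of the next stage. -/
abbrev StrategyOne (L I S : Type*) [Fintype L] : Type _ :=
  ∀ n : ℕ, (Fin n → L × I × S) → stdSimplex ℝ L

/-- A (behavioral) strategy of Player 2: given everything that happened in the first `n` stages, it
returns, measurably, the law of the flag of the next stage. -/
structure StrategyTwo (L I S : Type*) [Fintype S] [MeasurableSpace L] [MeasurableSpace I]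
    [MeasurableSpace S] where
  move : ∀ n : ℕ, Kernel (Fin n → Stage L I S) (Flag I S)
  markov : ∀ n : ℕ, IsMarkovKernel (move n)

/-- The stages `0, …, n` of a play, listed as a history of `n + 1` stages. -/
def historyOf {L I S : Type*} [Fintype S] {n : ℕ} (h : Finset.Iic n → Stage L I S) : Fin (n + 1) → Stage L I S :=
  fun m => h ⟨m, Finset.mem_Iic.2 (Nat.lt_succ_iff.1 m.2)⟩

lemma measurable_historyOf {L I S : Type*} [Fintype S] [MeasurableSpace L]
    [MeasurableSpace I] [MeasurableSpace S] {n : ℕ} :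
    Measurable (historyOf : (Finset.Iic n → Stage L I S) → Fin (n + 1) → Stage L I S) := by
  unfold historyOf
  fun_prop

section Law

variable {L I S : Type*} [Fintype L] [Fintype I] [Fintype S]

/-- The part of a history that Player 1 has observed. -/
def observed {n : ℕ} (h : Fin n → Stage L I S) : Fin n → L × I × S := fun m => (h m).2

/-- The weight of `(l, i, s)` at the stage that follows the history `h`, when Player 2 chooses the
flag `μ`: the type `l` has law `σ(h)` whatever `μ` is, given `l` the action has law `x(l)`,
and given `(l, i)` the signal has law `μ^i`. -/
def responseWeight (σ : StrategyOne L I S) (x : L → stdSimplex ℝ I) {n : ℕ}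
    (p : (Fin n → Stage L I S) × Flag I S) (a : L × I × S) : ℝ :=
  σ n (observed p.1) a.1 * x a.1 a.2.1 * p.2 a.2.1 a.2.2

lemma responseWeight_nonneg (σ : StrategyOne L I S) (x : L → stdSimplex ℝ I) {n : ℕ}
    (p : (Fin n → Stage L I S) × Flag I S) (a : L × I × S) : 0 ≤ responseWeight σ x p a :=
  mul_nonneg (mul_nonneg ((σ n (observed p.1)).2.1 _) ((x a.1).2.1 _)) ((p.2 a.2.1).2.1 _)

lemma sum_responseWeight (σ : StrategyOne L I S) (x : L → stdSimplex ℝ I) {n : ℕ}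
    (p : (Fin n → Stage L I S) × Flag I S) : ∑ a, responseWeight σ x p a = 1 := by
  have hS : ∀ i, ∑ s, p.2 i s = 1 := fun i => (p.2 i).2.2
  have hI : ∀ l, ∑ i, x l i = 1 := fun l => (x l).2.2
  have hL : ∑ l, σ n (observed p.1) l = 1 := (σ n (observed p.1)).2.2
  simp only [responseWeight, Fintype.sum_prod_type, ← Finset.mul_sum, hS, hI, mul_one, hL]

variable [MeasurableSpace L] [MeasurableSpace I] [MeasurableSpace S]
  [DiscreteMeasurableSpace L] [DiscreteMeasurableSpace I] [DiscreteMeasurableSpace S]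

lemma measurable_responseWeight (σ : StrategyOne L I S) (x : L → stdSimplex ℝ I) {n : ℕ}
    (a : L × I × S) :
    Measurable (fun p : (Fin n → Stage L I S) × Flag I S => responseWeight σ x p a) := by
  have h1 : Measurable (fun o : Fin n → L × I × S => (σ n o a.1 : ℝ)) := measurable_of_finite _
  have h2 : Measurable (fun p : (Fin n → Stage L I S) × Flag I S => observed p.1) := by
    unfold observed
    fun_prop
  have h3 : Measurable (fun p : (Fin n → Stage L I S) × Flag I S => (p.2 a.2.1 a.2.2 : ℝ)) :=
    (measurable_pi_apply a.2.2).comp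
      (measurable_subtype_coe.comp ((measurable_pi_apply a.2.1).comp measurable_snd))
  exact ((h1.comp h2).mul_const _).mul h3

/-- The law of `(l_n, i_n, s_n)` given the past and the flag chosen by Player 2. -/
def responseKernel (σ : StrategyOne L I S) (x : L → stdSimplex ℝ I) (n : ℕ) :
    Kernel ((Fin n → Stage L I S) × Flag I S) (L × I × S) where
  toFun p := ∑ a, ENNReal.ofReal (responseWeight σ x p a) • Measure.dirac a
  measurable' := by
    refine Measure.measurable_of_measurable_coe _ fun t _ => ?_
    simp only [Measure.coe_finsetSum, Measure.smul_apply, Finset.sum_apply, smul_eq_mul]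
    exact Finset.measurable_sum _ fun a _ =>
      ((measurable_responseWeight σ x a).ennreal_ofReal).mul_const _

instance (σ : StrategyOne L I S) (x : L → stdSimplex ℝ I) (n : ℕ) :
    IsMarkovKernel (responseKernel σ x n) := by
  refine ⟨fun p => ⟨?_⟩⟩
  change (∑ a, ENNReal.ofReal (responseWeight σ x p a) • Measure.dirac a) Set.univ = 1
  simp only [Measure.coe_finsetSum, Measure.smul_apply, Finset.sum_apply, smul_eq_mul,
    measure_univ, mul_one]
  rw [← ENNReal.ofReal_sum_of_nonneg fun a _ => responseWeight_nonneg σ x p a,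
    sum_responseWeight, ENNReal.ofReal_one]

/-- The law of the stage that follows a history of `n` stages: Player 2 draws a flag from his
strategy and, independently of this draw given the past, Player 1 draws his type and then his
action; the signal is drawn from the coordinate of the flag that corresponds to the action. -/
def stageKernel (σ : StrategyOne L I S) (x : L → stdSimplex ℝ I) (τ : StrategyTwo L I S) (n : ℕ) :
    Kernel (Fin n → Stage L I S) (Stage L I S) :=
  τ.move n ⊗ₖ responseKernel σ x n

instance (σ : StrategyOne L I S) (x : L → stdSimplex ℝ I) (τ : StrategyTwo L I S) (n : ℕ) :
    IsMarkovKernel (stageKernel σ x τ n) := by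
  have := τ.markov n
  unfold stageKernel
  infer_instance

/-- The probability `ℙ_{σ,τ}` on the set of plays (the first stage has number `0`), when
Player 1 chooses his types with `σ` and plays the mixed action `x(l)` at the stages of type `l`,
and Player 2 uses `τ`. It is the law given by the Ionescu-Tulcea theorem. -/
def playLaw (σ : StrategyOne L I S) (x : L → stdSimplex ℝ I) (τ : StrategyTwo L I S) :
    Measure (ℕ → Stage L I S) :=
  Kernel.trajMeasure (X := fun _ => Stage L I S) (stageKernel σ x τ 0 Fin.elim0)
    (fun n => (stageKernel σ x τ (n + 1)).comap historyOf measurable_historyOf)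

end Law

/-! ### Averages, regret, consistency, calibration -/

section Consistency

variable {L I S : Type*} [DecidableEq L] [DecidableEq I] [DecidableEq S] [Fintype S]

/-- `N_n(l)`: the stages of type `l` among the first `n` stages. -/
def stagesOfType (w : ℕ → Stage L I S) (n : ℕ) (l : L) : Finset ℕ :=
  (Finset.range n).filter fun m => (w m).type = l

/-- The average of the sequence `a` over the finite set `N` of stages. -/
def average {E : Type*} [AddCommGroup E] [Module ℝ E] (N : Finset ℕ) (a : ℕ → E) : E :=
  (N.card : ℝ)⁻¹ • ∑ m ∈ N, a m

/-- The average flag on the stages of type `l`. -/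
def averageFlag (w : ℕ → Stage L I S) (n : ℕ) (l : L) : I → S → ℝ :=
  average (stagesOfType w n l) fun m => (w m).flag.vec

/-- The empirical distribution of the actions of Player 1 on the stages of type `l`. -/
def averageAction (w : ℕ → Stage L I S) (n : ℕ) (l : L) : I → ℝ :=
  average (stagesOfType w n l) fun m => Pi.single (w m).action 1

/-- `|N_n(l)| / n`. -/
def frequency (w : ℕ → Stage L I S) (n : ℕ) (l : L) : ℝ := (stagesOfType w n l).card / n

/-- The average internal regret of type `l` after `n` stages. It is used where the
supremum is finite and only matters if `N_n(l)` is not empty. -/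
def regret [Fintype I] (G : (I → ℝ) → (I → S → ℝ) → ℝ) (w : ℕ → Stage L I S) (n : ℕ) (l : L) : ℝ :=
  ⨆ z : stdSimplex ℝ I, (G z (averageFlag w n l) - G (averageAction w n l) (averageFlag w n l))

/-- The strategy `σ`, with the mixed action `x(l)` at the stages of type `l`, is
`(L, ε)`-internally consistent for the evaluation function `G`. -/
def InternallyConsistent [Fintype L] [Fintype I]
    [MeasurableSpace L] [MeasurableSpace I] [MeasurableSpace S]
    [DiscreteMeasurableSpace L] [DiscreteMeasurableSpace I] [DiscreteMeasurableSpace S]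
    (G : (I → ℝ) → (I → S → ℝ) → ℝ) (ε : ℝ) (x : L → stdSimplex ℝ I) (σ : StrategyOne L I S) :
    Prop :=
  ∀ τ : StrategyTwo L I S, ∀ᵐ w ∂(playLaw σ x τ), ∀ l : L,
    limsup (fun n : ℕ => ((frequency w n l * (regret G w n l - ε) : ℝ) : EReal)) atTop ≤ 0

/-- The estimate `1{i_n = i} 1{s_n = s} / x(l_n)[i_n]` of the flag of a stage, when `x(l)` is
played at the stages of type `l`. -/
def estimate [Fintype I] (x : L → stdSimplex ℝ I) (v : Stage L I S) : I → S → ℝ :=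
  fun i s => if v.action = i ∧ v.signal = s then (x v.type v.action : ℝ)⁻¹ else 0

/-- The average of the estimates of the flags on the stages of type `l`. -/
def averageEstimate [Fintype I] (x : L → stdSimplex ℝ I) (w : ℕ → Stage L I S) (n : ℕ) (l : L) :
    I → S → ℝ :=
  average (stagesOfType w n l) fun m => estimate x (w m)

/-- The strategy `σ`, with the mixed action `x(l)` at the stages of type `l`, is calibrated with
respect to the grid `μ(l)` for the sequence of the estimates of the flags. -/
def CalibratedOnEstimates [Fintype L] [Fintype I]
    [MeasurableSpace L] [MeasurableSpace I] [MeasurableSpace S]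
    [DiscreteMeasurableSpace L] [DiscreteMeasurableSpace I] [DiscreteMeasurableSpace S]
    (μ : L → Flag I S) (x : L → stdSimplex ℝ I) (σ : StrategyOne L I S) : Prop :=
  ∀ τ : StrategyTwo L I S, ∀ᵐ w ∂(playLaw σ x τ), ∀ l k : L,
    limsup (fun n : ℕ => ((frequency w n l *
      (flagDist (averageEstimate x w n l) (μ l).vec ^ 2
        - flagDist (averageEstimate x w n l) (μ k).vec ^ 2) : ℝ) : EReal)) atTop ≤ 0

/-- `x' = (1 - η) x + η u`, where `u` is the uniform law on `I`. -/
def IsPerturbation [Fintype I] (η : ℝ) (x x' : stdSimplex ℝ I) : Prop :=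
  ∀ i, x' i = (1 - η) * x i + η * (Fintype.card I : ℝ)⁻¹

end Consistency

end PartialMonitoring

end

open PartialMonitoring

open Topology

namespace PartialMonitoring

/-! ### Nonnegative supermartingales along a play -/

section Supermartingale

variable {L I S : Type*} [Fintype L] [Fintype I] [Fintype S]
  [MeasurableSpace L] [MeasurableSpace I] [MeasurableSpace S]
  [DiscreteMeasurableSpace L] [DiscreteMeasurableSpace I] [DiscreteMeasurableSpace S]

/-! Player 1 estimates the flags without bias, calibrates his types on these estimates, and at a
stage of type `l` plays almost `x l`. Suppose that type `l` is used infinitely often. By laws of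
large numbers on its stages, the average estimate approaches the average flag, and the empirical
action approaches `y l`, hence ends up within `2η` of `x l`. Some grid point `μ k` is within `δ` of
the average flag; calibration makes `μ l` almost as close to the estimate, so the average flag is
within `2δ` of `μ l`, and regularity bounds the regret by `ε`. A type used finitely often has a
frequency that tends to zero.

Calibration and the laws of large numbers are both instances of `ae_typeSum_le`, a potential
argument in the style of Blackwell. A bounded payoff with sum `E` over the `N` stages of its type
contributes about `N^(-3/2) (E⁺)²`, plus a tail term that pays in advance for the second-order
increments. If the first-order increment is nonpositive on average against every flag, the total is
a nonnegative supermartingale, hence almost surely bounded, so `E⁺ = O(N^(3/4)) = o(N)`. Each payoff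
is weighted by the clock of its own type, so no change of time is needed.

A law of large numbers results from a centred payoff and its opposite. For calibration, payoff `(l,
k)` is the difference of the squared distances from the estimate to `μ l` and `μ k`, which is affine
in the estimate. The drift is then `∑ l, q l * ∑ k, g l k * (c l - c k)`, where `c l` is the score
of `μ l` against the true flag. It vanishes for all `c` once `q` is invariant for the rates `g`, and
`exists_invariant_probability` provides such a `q`. -/

instance isProbabilityMeasure_playLaw (σ : StrategyOne L I S) (x : L → stdSimplex ℝ I)
    (τ : StrategyTwo L I S) : IsProbabilityMeasure (playLaw σ x τ) := by
  unfold playLaw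
  infer_instance

/-- The first `n` stages of a play. -/
def past {E : Type*} (w : ℕ → E) (n : ℕ) : Fin n → E := fun m => w m

lemma measurable_past {E : Type*} [MeasurableSpace E] (n : ℕ) :
    Measurable fun w : ℕ → E => past w n := by
  unfold past
  fun_prop

lemma past_succ {E : Type*} (w : ℕ → E) (n : ℕ) :
    past w (n + 1) = Fin.snoc (α := fun _ => E) (past w n) (w n) := by
  ext m
  refine Fin.lastCases ?_ (fun m => ?_) m <;> simp [past]

lemma measurable_snoc {E : Type*} [MeasurableSpace E] (n : ℕ) :
    Measurable fun p : (Fin n → E) × E => (Fin.snoc (α := fun _ => E) p.1 p.2 : Fin (n + 1) → E) := by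
  refine measurable_pi_lambda _ fun m => ?_
  refine Fin.lastCases ?_ (fun m => ?_) m
  · simpa using measurable_snd
  · simpa using! (measurable_pi_apply m).comp (measurable_fst (α := Fin n → E) (β := E))

lemma integral_responseKernel (σ : StrategyOne L I S) (x : L → stdSimplex ℝ I) {n : ℕ}
    (p : (Fin n → Stage L I S) × Flag I S) (f : L × I × S → ℝ) :
    ∫ a, f a ∂(responseKernel σ x n p) = ∑ a, responseWeight σ x p a * f a := by
  change ∫ a, f a ∂(∑ a, ENNReal.ofReal (responseWeight σ x p a) • Measure.dirac a) = _
  rw [integral_finsetSum_measure]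
  · refine Finset.sum_congr rfl fun a _ => ?_
    rw [integral_smul_measure, integral_dirac,
      ENNReal.toReal_ofReal (responseWeight_nonneg σ x p a), smul_eq_mul]
  · intro a _
    exact (integrable_dirac (by simp)).smul_measure ENNReal.ofReal_ne_top

/-- The flag is integrated outermost: a bound valid for every flag survives any law of the flag, so
Player 2's strategy needs no further analysis. -/
lemma integral_stageKernel_le (σ : StrategyOne L I S) (x : L → stdSimplex ℝ I)
    (τ : StrategyTwo L I S) {n : ℕ} (h : Fin n → Stage L I S) {f : Stage L I S → ℝ} {c : ℝ}
    (hf : Integrable f (stageKernel σ x τ n h))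
    (hc : ∀ ν, ∑ a, responseWeight σ x (h, ν) a * f (ν, a) ≤ c) :
    ∫ v, f v ∂(stageKernel σ x τ n h) ≤ c := by
  have := τ.markov n
  unfold stageKernel at hf ⊢
  rw [integral_compProd hf]
  have hi := hf.integral_compProd
  simp only [integral_responseKernel] at hi ⊢
  calc _ ≤ ∫ _, c ∂(τ.move n h) := integral_mono hi (integrable_const c) hc
    _ = c := by simp

variable {σ : StrategyOne L I S} {x : L → stdSimplex ℝ I} {τ : StrategyTwo L I S}

/-- A function of the past is integrated over the next stage with the kernel of that stage. -/
lemma setIntegral_playLaw_succ (n : ℕ) {f : (Fin (n + 2) → Stage L I S) → ℝ} (hf : Measurable f)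
    {C : ℝ} (hC : ∀ h, |f h| ≤ C) {A : Set (Finset.Iic n → Stage L I S)} (hA : MeasurableSet A) :
    ∫ w in Preorder.frestrictLe (π := fun _ => Stage L I S) n ⁻¹' A, f (past w (n + 2))
        ∂(playLaw σ x τ) =
      ∫ w in Preorder.frestrictLe (π := fun _ => Stage L I S) n ⁻¹' A,
        ∫ v, f (Fin.snoc (α := fun _ => Stage L I S) (past w (n + 1)) v)
          ∂(stageKernel σ x τ (n + 1) (past w (n + 1))) ∂(playLaw σ x τ) := by
  -- The joint law of the stages `0, …, n` and of stage `n + 1` is the law of the former composed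
  -- with the stage kernel.
  have key := Kernel.map_frestrictLe_trajMeasure_compProd_eq_map_trajMeasure
    (X := fun _ => Stage L I S)
    (κ := fun n => (stageKernel σ x τ (n + 1)).comap historyOf measurable_historyOf)
    (μ₀ := stageKernel σ x τ 0 Fin.elim0) (a := n)
  change (playLaw σ x τ).map _ ⊗ₘ _ = (playLaw σ x τ).map _ at key
  have hr : Measurable (Preorder.frestrictLe (π := fun _ => Stage L I S) n) := by fun_prop
  let g : (Finset.Iic n → Stage L I S) × Stage L I S → ℝ := fun p =>
    f (Fin.snoc (α := fun _ => Stage L I S) (historyOf p.1) p.2)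
  have hg : Measurable g :=
    hf.comp ((measurable_snoc _).comp
      ((measurable_historyOf.comp measurable_fst).prodMk measurable_snd))
  have hp : ∀ w : ℕ → Stage L I S,
      historyOf (Preorder.frestrictLe (π := fun _ => Stage L I S) n w) = past w (n + 1) :=
    fun w => rfl
  have hpair : Measurable fun w : ℕ → Stage L I S =>
      (Preorder.frestrictLe (π := fun _ => Stage L I S) n w, w (n + 1)) := by fun_prop
  have e1 : ∫ w in Preorder.frestrictLe (π := fun _ => Stage L I S) n ⁻¹' A, f (past w (n + 2))
      ∂(playLaw σ x τ) = ∫ p in A ×ˢ Set.univ, g p ∂((playLaw σ x τ).map fun w =>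
        (Preorder.frestrictLe (π := fun _ => Stage L I S) n w, w (n + 1))) := by
    rw [setIntegral_map (hA.prod MeasurableSet.univ) hg.aestronglyMeasurable hpair.aemeasurable]
    have : (fun w : ℕ → Stage L I S =>
        (Preorder.frestrictLe (π := fun _ => Stage L I S) n w, w (n + 1))) ⁻¹' A ×ˢ Set.univ =
        Preorder.frestrictLe (π := fun _ => Stage L I S) n ⁻¹' A := by
      ext w; simp
    rw [this]
    refine integral_congr_ae (Eventually.of_forall fun w => ?_)
    simp only [g, hp, past_succ w (n + 1)]
  have hprob : IsProbabilityMeasure ((playLaw σ x τ).map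
      (Preorder.frestrictLe (π := fun _ => Stage L I S) n)) :=
    Measure.isProbabilityMeasure_map hr.aemeasurable
  have hgi : Integrable g (((playLaw σ x τ).map
      (Preorder.frestrictLe (π := fun _ => Stage L I S) n)) ⊗ₘ
        ((stageKernel σ x τ (n + 1)).comap historyOf measurable_historyOf)) :=
    Integrable.of_bound hg.aestronglyMeasurable C (Eventually.of_forall fun p => by
      simpa using hC _)
  rw [e1, ← key, Measure.setIntegral_compProd hA MeasurableSet.univ hgi.integrableOn]
  simp only [Measure.restrict_univ]
  rw [setIntegral_map hA _ hr.aemeasurable]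
  · rfl
  · exact hg.stronglyMeasurable.integral_kernel_prod_right'.aestronglyMeasurable

/-- A nonnegative function of the history that decreases on average, whatever flag Player 2
chooses, is almost surely bounded along the play. -/
theorem ae_bounded_of_decreasing (F : ∀ n, (Fin n → Stage L I S) → ℝ)
    (hmeas : ∀ n, Measurable (F n)) (hnn : ∀ n h, 0 ≤ F n h) (hbd : ∀ n, ∃ C, ∀ h, F n h ≤ C)
    (hdec : ∀ n h ν, ∑ a, responseWeight σ x (h, ν) a *
      F (n + 1) (Fin.snoc (α := fun _ => Stage L I S) h (ν, a)) ≤ F n h) :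
    ∀ᵐ w ∂(playLaw σ x τ), ∃ C, ∀ n, F n (past w n) ≤ C := by
  let ℱ : Filtration ℕ _ := Filtration.piLE (X := fun _ => Stage L I S)
  -- The index is shifted because the filtration at time `n` already knows the `n + 1` stages `0, …,
  -- n`.
  let M : ℕ → (ℕ → Stage L I S) → ℝ := fun n w => F (n + 1) (past w (n + 1))
  have hMm : ∀ n, Measurable (M n) := fun n => (hmeas _).comp (measurable_past _)
  have habs : ∀ n, ∃ C, ∀ h, |F n h| ≤ C := fun n => by
    obtain ⟨C, hC⟩ := hbd n
    exact ⟨C, fun h => by rw [abs_of_nonneg (hnn n h)]; exact hC h⟩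
  have hint : ∀ n, Integrable (M n) (playLaw σ x τ) := fun n => by
    obtain ⟨C, hC⟩ := habs (n + 1)
    exact Integrable.of_bound (hMm n).aestronglyMeasurable C
      (Eventually.of_forall fun w => hC _)
  have hadp : StronglyAdapted ℱ M := by
    intro n
    refine Measurable.stronglyMeasurable ?_
    have : M n = (fun h => F (n + 1) (historyOf h)) ∘
        Preorder.frestrictLe (π := fun _ => Stage L I S) n := rfl
    rw [this]
    refine ((hmeas (n + 1)).comp measurable_historyOf).comp ?_
    change Measurable[Filtration.piLE (X := fun _ => Stage L I S) n] _
    rw [Filtration.piLE_eq_comap_frestrictLe]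
    exact comap_measurable _
  have hsup : Supermartingale M ℱ (playLaw σ x τ) := by
    refine supermartingale_of_setIntegral_succ_le hadp hint fun n s hs => ?_
    change MeasurableSet[Filtration.piLE (X := fun _ => Stage L I S) n] s at hs
    rw [Filtration.piLE_eq_comap_frestrictLe] at hs
    obtain ⟨A, hA, rfl⟩ := hs
    obtain ⟨C, hC⟩ := habs (n + 2)
    have hr : Measurable (Preorder.frestrictLe (π := fun _ => Stage L I S) n) := by fun_prop
    have hin : ∀ w : ℕ → Stage L I S,
        Integrable (fun v => F (n + 2) (Fin.snoc (α := fun _ => Stage L I S) (past w (n + 1)) v))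
          (stageKernel σ x τ (n + 1) (past w (n + 1))) := fun w => by
      have hm : Measurable fun v : Stage L I S =>
          F (n + 2) (Fin.snoc (α := fun _ => Stage L I S) (past w (n + 1)) v) :=
        (hmeas (n + 2)).comp ((measurable_snoc (n + 1)).comp
          (measurable_const (a := past w (n + 1)).prodMk measurable_id))
      exact Integrable.of_bound hm.aestronglyMeasurable C (Eventually.of_forall fun v => hC _)
    calc _ = _ := setIntegral_playLaw_succ n (hmeas (n + 2)) hC hA
      _ ≤ _ := by
        refine integral_mono_of_nonneg (Eventually.of_forall fun w => ?_)
          (hint n).integrableOn (Eventually.of_forall fun w => ?_)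
        · exact integral_nonneg fun v => hnn _ _
        · exact integral_stageKernel_le σ x τ _ (hin w) fun ν => hdec _ _ ν
  have hle : ∀ n, ∫ w, M n w ∂(playLaw σ x τ) ≤ ∫ w, M 0 w ∂(playLaw σ x τ) := fun n => by
    simpa using hsup.setIntegral_le (Nat.zero_le n) MeasurableSet.univ
  -- The convergence theorem is for `L¹`-bounded submartingales, hence the sign. As `M` is
  -- nonnegative, its `L¹` norm is its expectation, which never exceeds that of `M 0`.
  have hconv := hsup.neg.ae_tendsto_limitProcess
    (R := (∫ w, M 0 w ∂(playLaw σ x τ)).toNNReal) fun n => by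
    rw [Pi.neg_apply, eLpNorm_neg, eLpNorm_one_eq_lintegral_enorm]
    have : ∀ w, ‖M n w‖ₑ = ENNReal.ofReal (M n w) := fun w =>
      Real.enorm_of_nonneg (hnn _ _)
    simp only [this]
    rw [← ofReal_integral_eq_lintegral_ofReal (hint n) (Eventually.of_forall fun w => hnn _ _)]
    exact ENNReal.ofReal_le_ofReal (hle n)
  filter_upwards [hconv] with w hw
  obtain ⟨C, hC⟩ := hw.bddBelow_range
  -- The empty history is not covered by `M` and is bounded separately.
  refine ⟨max (-C) (F 0 (past w 0)), fun n => ?_⟩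
  rcases n with _ | n
  · exact le_max_right _ _
  · refine le_trans ?_ (le_max_left _ _)
    have := hC ⟨n, rfl⟩
    simp only [Pi.neg_apply, M] at this
    linarith

end Supermartingale

/-! ### Weights and the one-step inequality for the potential -/

section Weights

/-- The summable weights `(n + 1) ^ (-3/2)`. -/
noncomputable def stepWeight (n : ℕ) : ℝ := (((n : ℝ) + 1) * √((n : ℝ) + 1))⁻¹

/-- A bound on the tails of the sums of the weights. -/
noncomputable def tailWeight (n : ℕ) : ℝ := 2 / √((n : ℝ) + 1)

lemma stepWeight_nonneg (n : ℕ) : 0 ≤ stepWeight n := by unfold stepWeight; positivity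

lemma tailWeight_nonneg (n : ℕ) : 0 ≤ tailWeight n := by unfold tailWeight; positivity

lemma stepWeight_succ_le (n : ℕ) : stepWeight (n + 1) ≤ stepWeight n := by
  unfold stepWeight
  push_cast
  gcongr <;> linarith

lemma stepWeight_le_one (n : ℕ) : stepWeight n ≤ 1 := by
  unfold stepWeight
  have h : (1 : ℝ) ≤ (n : ℝ) + 1 := by linarith [n.cast_nonneg (α := ℝ)]
  exact inv_le_one_of_one_le₀ (one_le_mul_of_one_le_of_one_le h (Real.one_le_sqrt.2 h))

lemma tailWeight_le_two (n : ℕ) : tailWeight n ≤ 2 := by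
  unfold tailWeight
  have h : (1 : ℝ) ≤ (n : ℝ) + 1 := by linarith [n.cast_nonneg (α := ℝ)]
  exact div_le_self (by norm_num) (Real.one_le_sqrt.2 h)

/-- With `s = √(n+1)` and `t = √(n+2)`, the identity `(t - s)(t + s) = 1` gives `t - s ≥ 1/(2t)`, so
`2/s - 2/t ≥ 1/(s t²) ≥ 1/t³`, which is the weight. -/
lemma tailWeight_succ_add_le (n : ℕ) : tailWeight (n + 1) + stepWeight (n + 1) ≤ tailWeight n := by
  unfold stepWeight tailWeight
  push_cast
  set s := √((n : ℝ) + 1) with hs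
  set t := √((n : ℝ) + 1 + 1) with ht
  have s0 : 0 < s := Real.sqrt_pos.2 (by positivity)
  have t0 : 0 < t := Real.sqrt_pos.2 (by positivity)
  have hst : s ≤ t := Real.sqrt_le_sqrt (by linarith)
  have s2 : s ^ 2 = (n : ℝ) + 1 := Real.sq_sqrt (by positivity)
  have t2 : t ^ 2 = (n : ℝ) + 1 + 1 := Real.sq_sqrt (by positivity)
  rw [← t2, inv_eq_one_div, div_add_div _ _ (by positivity) (by positivity),
    div_le_div_iff₀ (by positivity) s0]
  have h1 : (t - s) * (t + s) = 1 := by linear_combination t2 - s2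
  have h2 : 0 ≤ t - s := by linarith
  have h3 : 1 ≤ (t - s) * (2 * t) := by rw [← h1]; gcongr; linarith
  nlinarith [mul_le_mul_of_nonneg_left h3 t0.le, mul_le_mul_of_nonneg_left hst t0.le]

/-- Since `n + 1 ≤ 2n`, replacing `n²` by `(n+1)²` costs at most a factor 4. -/
lemma sqrt_div_four_le (n : ℕ) (hn : 1 ≤ n) : √((n : ℝ) + 1) / 4 ≤ stepWeight n * (n : ℝ) ^ 2 := by
  unfold stepWeight
  have hn' : (1 : ℝ) ≤ n := by exact_mod_cast hn
  set s := √((n : ℝ) + 1) with hs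
  have s0 : 0 < s := Real.sqrt_pos.2 (by positivity)
  have s2 : s ^ 2 = (n : ℝ) + 1 := Real.sq_sqrt (by positivity)
  rw [inv_mul_eq_div, div_le_div_iff₀ (by norm_num) (by positivity)]
  have : s * (((n : ℝ) + 1) * s) = ((n : ℝ) + 1) ^ 2 := by rw [← s2]; ring
  rw [this]
  nlinarith

/-- A bound on `stepWeight N * E²` forces `E = o(N)`. -/
lemma eventually_le_mul_of_stepWeight_bounded {N : ℕ → ℕ} {E : ℕ → ℝ} {C : ℝ}
    (hN : Tendsto N atTop atTop) (hC : ∀ n, stepWeight (N n) * max (E n) 0 ^ 2 ≤ C)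
    {ε : ℝ} (hε : 0 < ε) : ∀ᶠ n in atTop, E n ≤ ε * N n := by
  have h1 : Tendsto (fun n => ε ^ 2 * (√((N n : ℝ) + 1) / 4)) atTop atTop := by
    refine Tendsto.const_mul_atTop (by positivity) (Tendsto.atTop_div_const (by norm_num) ?_)
    exact Real.tendsto_sqrt_atTop.comp (tendsto_atTop_add_const_right _ _
      (tendsto_natCast_atTop_atTop.comp hN))
  filter_upwards [h1.eventually_gt_atTop C, hN.eventually_ge_atTop 1] with n h2 h3
  by_contra! h4
  -- Otherwise the weighted square would be at least `ε² √(N+1) / 4`, which eventually exceeds `C`.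
  have h5 : ε * N n ≤ max (E n) 0 := h4.le.trans (le_max_left _ _)
  have h6 : (ε * N n) ^ 2 ≤ max (E n) 0 ^ 2 := pow_le_pow_left₀ (by positivity) h5 2
  have h7 := mul_le_mul_of_nonneg_left h6 (stepWeight_nonneg (N n))
  have h8 := mul_le_mul_of_nonneg_left (sqrt_div_four_le _ h3) (sq_nonneg ε)
  nlinarith [hC n]

/-- Expanding the square leaves a first-order term, whose mean is controlled by the strategy, and a
term at most `B²` times the new weight, which the decrease of the tail absorbs. -/
lemma potential_step (N : ℕ) {E u B : ℝ} (hu : |u| ≤ B) :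
    stepWeight (N + 1) * max (E + u) 0 ^ 2 + B ^ 2 * tailWeight (N + 1) ≤
      stepWeight N * max E 0 ^ 2 + B ^ 2 * tailWeight N +
        2 * (stepWeight (N + 1) * max E 0 * u) := by
  have h1 : max (E + u) 0 ^ 2 ≤ (max E 0 + u) ^ 2 := by
    rcases le_total (E + u) 0 with h | h
    · rw [max_eq_right h]; nlinarith [sq_nonneg (max E 0 + u)]
    · rw [max_eq_left h]
      exact pow_le_pow_left₀ h (by linarith [le_max_left E 0]) 2
  have h2 : u ^ 2 ≤ B ^ 2 := sq_le_sq' (by linarith [(abs_le.1 hu).1]) (abs_le.1 hu).2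
  have h3 := stepWeight_nonneg (N + 1)
  calc _ ≤ stepWeight (N + 1) * (max E 0 ^ 2 + 2 * max E 0 * u + B ^ 2)
        + B ^ 2 * tailWeight (N + 1) := by gcongr; nlinarith
    _ = stepWeight (N + 1) * max E 0 ^ 2 + B ^ 2 * (tailWeight (N + 1) + stepWeight (N + 1)) +
        2 * (stepWeight (N + 1) * max E 0 * u) := by ring
    _ ≤ _ := by
      have h4 := tailWeight_succ_add_le N
      have h5 := stepWeight_succ_le N
      gcongr

end Weights

/-! ### Counts and sums over the stages of one type -/

section Counts

variable {α L : Type*} [DecidableEq L]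

/-- The number of entries of type `l` in a finite sequence. -/
def typeCount (t : α → L) {n : ℕ} (h : Fin n → α) (l : L) : ℕ := ∑ m, if t (h m) = l then 1 else 0

/-- The sum of `u` over the entries of type `l` in a finite sequence. -/
def typeSum (t : α → L) (u : α → ℝ) {n : ℕ} (h : Fin n → α) (l : L) : ℝ :=
  ∑ m, if t (h m) = l then u (h m) else 0

lemma typeCount_snoc (t : α → L) {n : ℕ} (h : Fin n → α) (v : α) (l : L) :
    typeCount t (Fin.snoc (α := fun _ => α) h v : Fin (n + 1) → α) l =
      typeCount t h l + if t v = l then 1 else 0 := by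
  simp only [typeCount, Fin.sum_univ_castSucc, Fin.snoc_castSucc, Fin.snoc_last]

lemma typeSum_snoc (t : α → L) (u : α → ℝ) {n : ℕ} (h : Fin n → α) (v : α) (l : L) :
    typeSum t u (Fin.snoc (α := fun _ => α) h v : Fin (n + 1) → α) l =
      typeSum t u h l + if t v = l then u v else 0 := by
  simp [typeSum, Fin.sum_univ_castSucc]

lemma typeSum_le (t : α → L) {u : α → ℝ} {B : ℝ} (hu : ∀ v, |u v| ≤ B) (hB : 0 ≤ B) {n : ℕ}
    (h : Fin n → α) (l : L) : typeSum t u h l ≤ n * B := by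
  calc typeSum t u h l ≤ ∑ _ : Fin n, B := Finset.sum_le_sum fun m _ => by
        split_ifs
        · exact (le_abs_self _).trans (hu _)
        · exact hB
    _ = n * B := by simp

lemma typeCount_past {I S : Type*} [Fintype S] (w : ℕ → Stage L I S) (n : ℕ) (l : L) :
    typeCount Stage.type (past w n) l = (stagesOfType w n l).card := by
  rw [stagesOfType, Finset.card_filter]
  exact Fin.sum_univ_eq_sum_range (fun m => if (w m).type = l then 1 else 0) n

lemma typeSum_past {I S : Type*} [Fintype S] (w : ℕ → Stage L I S) (u : Stage L I S → ℝ) (n : ℕ)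
    (l : L) : typeSum Stage.type u (past w n) l = ∑ m ∈ stagesOfType w n l, u (w m) := by
  rw [stagesOfType, Finset.sum_filter]
  exact Fin.sum_univ_eq_sum_range (fun m => if (w m).type = l then u (w m) else 0) n

end Counts

/-! ### The potential argument and laws of large numbers -/

section Approachability

variable {J L I S : Type*} [Fintype J] [Fintype S] [DecidableEq L]

/-- The potential of a history, for payoffs `u j` that are collected at the stages of type `t j`. -/
noncomputable def potential (t : J → L) (u : J → Stage L I S → ℝ) (B : ℝ) (n : ℕ)
    (h : Fin n → Stage L I S) : ℝ :=
  ∑ j, (stepWeight (typeCount Stage.type h (t j)) *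
      max (typeSum Stage.type (u j) h (t j)) 0 ^ 2 +
    B ^ 2 * tailWeight (typeCount Stage.type h (t j)))

/-- Only the summands whose type is that of the new stage move; the clocks and sums of the others
are frozen. -/
lemma potential_snoc_le (t : J → L) {u : J → Stage L I S → ℝ} {B : ℝ} (hB : ∀ j v, |u j v| ≤ B)
    {n : ℕ} (h : Fin n → Stage L I S) (v : Stage L I S) :
    potential t u B (n + 1) (Fin.snoc (α := fun _ => Stage L I S) h v) ≤ potential t u B n h +
      2 * ∑ j, if v.type = t j then stepWeight (typeCount Stage.type h (t j) + 1) *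
        max (typeSum Stage.type (u j) h (t j)) 0 * u j v else 0 := by
  unfold potential
  rw [Finset.mul_sum, ← Finset.sum_add_distrib]
  refine Finset.sum_le_sum fun j _ => ?_
  rw [typeCount_snoc, typeSum_snoc]
  split_ifs
  · exact potential_step _ (hB j v)
  · simp

variable [MeasurableSpace L] [MeasurableSpace I] [MeasurableSpace S] [DiscreteMeasurableSpace L]

lemma measurable_typeCount (n : ℕ) (l : L) :
    Measurable fun h : Fin n → Stage L I S => typeCount Stage.type h l := by
  unfold typeCount
  refine Finset.measurable_sum _ fun m _ => Measurable.ite ?_ measurable_const measurable_const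
  have : Measurable fun h : Fin n → Stage L I S => (h m).type := by
    unfold Stage.type; fun_prop
  exact this (MeasurableSet.singleton l)

lemma measurable_typeSum {u : Stage L I S → ℝ} (hu : Measurable u) (n : ℕ) (l : L) :
    Measurable fun h : Fin n → Stage L I S => typeSum Stage.type u h l := by
  unfold typeSum
  refine Finset.measurable_sum _ fun m _ => Measurable.ite ?_
    (hu.comp (measurable_pi_apply m)) measurable_const
  have : Measurable fun h : Fin n → Stage L I S => (h m).type := by
    unfold Stage.type; fun_prop
  exact this (MeasurableSet.singleton l)

lemma measurable_potential (t : J → L) {u : J → Stage L I S → ℝ} (hu : ∀ j, Measurable (u j))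
    (B : ℝ) (n : ℕ) : Measurable (potential t u B n) := by
  unfold potential
  refine Finset.measurable_sum _ fun j _ => ?_
  have h1 := measurable_typeCount (I := I) (S := S) n (t j)
  have h2 := measurable_typeSum (hu j) n (t j)
  have h3 (f : ℕ → ℝ) : Measurable fun h : Fin n → Stage L I S =>
      f (typeCount Stage.type h (t j)) := measurable_from_nat.comp h1
  exact ((h3 stepWeight).mul ((h2.max measurable_const).pow_const 2)).add
    ((h3 tailWeight).const_mul _)

variable [Fintype L] [Fintype I] [DiscreteMeasurableSpace I] [DiscreteMeasurableSpace S]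

/-- Payoffs `u j` collected at the stages of type `t j`: if the payoffs weighted by the positive
parts of their past sums are nonpositive on average, then the sum of each of them is almost surely
at most negligible with respect to the number of stages of its type, if that number is infinite. -/
theorem ae_typeSum_le {σ : StrategyOne L I S} {x : L → stdSimplex ℝ I} {τ : StrategyTwo L I S}
    (t : J → L) {u : J → Stage L I S → ℝ} (hu : ∀ j, Measurable (u j)) {B : ℝ}
    (hB : ∀ j v, |u j v| ≤ B)
    (hdrift : ∀ n (h : Fin n → Stage L I S) ν, ∑ a, responseWeight σ x (h, ν) a *
      (∑ j, if a.1 = t j then stepWeight (typeCount Stage.type h (t j) + 1) *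
        max (typeSum Stage.type (u j) h (t j)) 0 * u j (ν, a) else 0) ≤ 0) :
    ∀ᵐ w ∂(playLaw σ x τ), ∀ j,
      Tendsto (fun n => (stagesOfType w n (t j)).card) atTop atTop → ∀ ε > 0,
        ∀ᶠ n in atTop, ∑ m ∈ stagesOfType w n (t j), u j (w m) ≤
          ε * (stagesOfType w n (t j)).card := by
  have hterm : ∀ (n : ℕ) (h : Fin n → Stage L I S) (j : J), 0 ≤
      stepWeight (typeCount Stage.type h (t j)) * max (typeSum Stage.type (u j) h (t j)) 0 ^ 2 +
      B ^ 2 * tailWeight (typeCount Stage.type h (t j)) := fun n h j =>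
    add_nonneg (mul_nonneg (stepWeight_nonneg _) (sq_nonneg _))
      (mul_nonneg (sq_nonneg _) (tailWeight_nonneg _))
  have key := ae_bounded_of_decreasing (σ := σ) (x := x) (τ := τ) (potential t u B)
    (measurable_potential t hu B) (fun n h => Finset.sum_nonneg fun j _ => hterm n h j)
    (fun n => ⟨∑ _ : J, (1 * (n * |B|) ^ 2 + B ^ 2 * 2), fun h =>
      Finset.sum_le_sum fun j _ => by
        have h1 : max (typeSum Stage.type (u j) h (t j)) 0 ≤ n * |B| :=
          max_le (typeSum_le _ (fun v => (hB j v).trans (le_abs_self B)) (abs_nonneg B) h _)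
            (by positivity)
        have h2 := stepWeight_le_one (typeCount Stage.type h (t j))
        have h3 := tailWeight_le_two (typeCount Stage.type h (t j))
        have h4 := stepWeight_nonneg (typeCount Stage.type h (t j))
        gcongr⟩)
    (fun n h ν => by
      calc _ ≤ ∑ a, responseWeight σ x (h, ν) a * (potential t u B n h +
            2 * ∑ j, if a.1 = t j then stepWeight (typeCount Stage.type h (t j) + 1) *
              max (typeSum Stage.type (u j) h (t j)) 0 * u j (ν, a) else 0) :=
            Finset.sum_le_sum fun a _ => mul_le_mul_of_nonneg_left
              (potential_snoc_le t hB h (ν, a)) (responseWeight_nonneg σ x _ a)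
        _ = (∑ a, responseWeight σ x (h, ν) a) * potential t u B n h +
            2 * ∑ a, responseWeight σ x (h, ν) a * (∑ j, if a.1 = t j then
              stepWeight (typeCount Stage.type h (t j) + 1) *
              max (typeSum Stage.type (u j) h (t j)) 0 * u j (ν, a) else 0) := by
            rw [Finset.sum_mul, Finset.mul_sum, ← Finset.sum_add_distrib]
            refine Finset.sum_congr rfl fun a _ => by ring
        _ ≤ _ := by
            rw [sum_responseWeight]
            linarith [hdrift n h ν])
  filter_upwards [key] with w hw j hN ε hε
  obtain ⟨C, hC⟩ := hw
  refine eventually_le_mul_of_stepWeight_bounded hN (C := C) (fun n => ?_) hε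
  rw [← typeCount_past, ← typeSum_past]
  refine le_trans ?_ (hC n)
  refine le_trans ?_ (Finset.single_le_sum (fun j _ => hterm n (past w n) j) (Finset.mem_univ j))
  exact le_add_of_nonneg_right (mul_nonneg (sq_nonneg _) (tailWeight_nonneg _))

/-- Strong law of large numbers on the stages of a given type. -/
theorem ae_average_tendsto_zero {σ : StrategyOne L I S} {x : L → stdSimplex ℝ I}
    {τ : StrategyTwo L I S} (l : L) {u : Stage L I S → ℝ} (hu : Measurable u) {B : ℝ}
    (hB : ∀ v, |u v| ≤ B)
    (hmean : ∀ ν : Flag I S, ∑ i, ∑ s, (x l i : ℝ) * ν i s * u (ν, l, i, s) = 0) :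
    ∀ᵐ w ∂(playLaw σ x τ), Tendsto (fun n => (stagesOfType w n l).card) atTop atTop →
      Tendsto (fun n => average (stagesOfType w n l) fun m => u (w m)) atTop (𝓝 0) := by
  -- The two indices carry `u` and `-u`, so that one-sided bounds give a two-sided one.
  have key := ae_typeSum_le (J := Bool) (σ := σ) (x := x) (τ := τ) (fun _ => l)
    (u := fun b v => (if b then 1 else -1) * u v) (fun b => hu.const_mul _) (B := B)
    (fun b v => by cases b <;> simpa using hB v)
    (fun n h ν => by
      refine le_of_eq ?_
      simp_rw [Finset.mul_sum]
      rw [Finset.sum_comm]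
      refine Finset.sum_eq_zero fun b _ => ?_
      -- The weight and the sign depend only on the past and on `b`, so they factor out of the
      -- conditional mean, which is zero.
      generalize stepWeight (typeCount Stage.type h l + 1) * max (typeSum _ _ h l) 0 = c
      generalize (if b = true then (1 : ℝ) else -1) = d
      simp_rw [Fintype.sum_prod_type, responseWeight, mul_ite, mul_zero]
      rw [Finset.sum_eq_single l (fun k _ hk => by simp [hk]) (by simp)]
      simp only [if_true]
      calc _ = σ n (observed h) l * c * d *
            ∑ i, ∑ s, (x l i : ℝ) * ν i s * u (ν, l, i, s) := by
            simp_rw [Finset.mul_sum]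
            refine Finset.sum_congr rfl fun i _ => Finset.sum_congr rfl fun s _ => by ring
        _ = 0 := by rw [hmean, mul_zero])
  filter_upwards [key] with w hw hN
  rw [Metric.tendsto_nhds]
  intro ε hε
  filter_upwards [hw true hN (ε / 2) (by positivity), hw false hN (ε / 2) (by positivity),
    hN.eventually_ge_atTop 1] with n h1 h2 h3
  have h4 : (0 : ℝ) < (stagesOfType w n l).card := by exact_mod_cast h3
  simp only [if_true, one_mul, Bool.false_eq_true, if_false, neg_one_mul,
    Finset.sum_neg_distrib] at h1 h2
  rw [Real.dist_eq, sub_zero, average, smul_eq_mul, inv_mul_eq_div, abs_div, abs_of_pos h4,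
    div_lt_iff₀ h4]
  exact (abs_le.2 ⟨by linarith, h1⟩).trans_lt (by nlinarith)

end Approachability

/-! ### Invariant probabilities -/

/-- A matrix of nonnegative rates has an invariant probability. -/
theorem exists_invariant_probability {L : Type*} [Fintype L] [Nonempty L] (g : L → L → ℝ)
    (hg : ∀ l k, 0 ≤ g l k) :
    ∃ q : stdSimplex ℝ L, ∀ l, q l * ∑ k, g l k = ∑ k, q k * g k l := by
  classical
  -- The rows of `Q` sum to zero, so `Q` is singular and has a nonzero left null vector, of unknown
  -- signs.
  let Q : Matrix L L ℝ := fun l k => g l k - if l = k then ∑ k', g l k' else 0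
  have hQ : Q.mulVec 1 = 0 := by
    ext l
    simp [Q, Matrix.mulVec, dotProduct, Finset.sum_sub_distrib]
  obtain ⟨v, hv0, hv⟩ := Matrix.exists_vecMul_eq_zero_iff.2
    (Matrix.exists_mulVec_eq_zero_iff.1 ⟨1, one_ne_zero, hQ⟩)
  have hv' : ∀ l, v l * ∑ k, g l k = ∑ k, v k * g k l := fun l => by
    have := congrFun hv l
    simp only [Q, Matrix.vecMul, dotProduct, mul_sub, Finset.sum_sub_distrib, mul_ite, mul_zero,
      Finset.sum_ite_eq', Finset.mem_univ, if_true, Pi.zero_apply] at this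
    linarith
  have hle : ∀ l ∈ Finset.univ, |v l| * ∑ k, g l k ≤ ∑ k, |v k| * g k l := fun l _ => by
    calc |v l| * ∑ k, g l k = |∑ k, v k * g k l| := by
          rw [← hv', abs_mul, abs_of_nonneg (Finset.sum_nonneg fun k _ => hg l k)]
      _ ≤ ∑ k, |v k * g k l| := Finset.abs_sum_le_sum_abs _ _
      _ = _ := Finset.sum_congr rfl fun k _ => by rw [abs_mul, abs_of_nonneg (hg k l)]
  -- Both sides of `hle` have the same total over `l`, so every inequality is an equality and `|v|`
  -- is invariant too.
  have heq := (Finset.sum_eq_sum_iff_of_le hle).1 (by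
    simp_rw [Finset.mul_sum]
    rw [Finset.sum_comm])
  have hpos : 0 < ∑ l, |v l| := by
    obtain ⟨l, hl⟩ := Function.ne_iff.1 hv0
    exact Finset.sum_pos' (fun _ _ => abs_nonneg _) ⟨l, Finset.mem_univ _, abs_pos.2 hl⟩
  refine ⟨⟨fun l => (∑ k, |v k|)⁻¹ * |v l|, fun l => by positivity, ?_⟩, fun l => ?_⟩
  · rw [← Finset.mul_sum, inv_mul_cancel₀ hpos.ne']
  · change (∑ k, |v k|)⁻¹ * |v l| * _ = ∑ k, (∑ k, |v k|)⁻¹ * |v k| * g k l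
    simp_rw [mul_assoc]
    rw [← Finset.mul_sum, heq l (Finset.mem_univ l)]

/-! ### Euclidean norms and perturbed mixed actions -/

section Euclidean

variable {A I S : Type*} [Fintype A] [Fintype I] [Fintype S]

lemma norm2_eq_norm (v : A → ℝ) : norm2 v = ‖WithLp.toLp 2 v‖ := by
  simp [norm2, EuclideanSpace.norm_eq]

lemma norm2_add_le (u v : A → ℝ) : norm2 (fun a => u a + v a) ≤ norm2 u + norm2 v := by
  simp only [norm2_eq_norm]
  exact norm_add_le (WithLp.toLp 2 u) (WithLp.toLp 2 v)

lemma norm2_const_mul (c : ℝ) (v : A → ℝ) : norm2 (fun a => c * v a) = |c| * norm2 v := by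
  simp only [norm2_eq_norm]
  exact norm_smul c (WithLp.toLp 2 v)

lemma tendsto_norm2_zero {ι : Type*} {f : Filter ι} {v : ι → A → ℝ}
    (hv : ∀ a, Tendsto (fun n => v n a) f (𝓝 0)) : Tendsto (fun n => norm2 (v n)) f (𝓝 0) := by
  have h : Tendsto (fun n => √(∑ a, v n a ^ 2)) f (𝓝 √(∑ _ : A, (0 : ℝ) ^ 2)) :=
    (tendsto_finsetSum _ fun a _ => (hv a).pow 2).sqrt
  simpa [norm2] using h

lemma flagDist_nonneg (u v : I → S → ℝ) : 0 ≤ flagDist u v := Real.sqrt_nonneg _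

lemma flagDist_triangle (u v w : I → S → ℝ) : flagDist u w ≤ flagDist u v + flagDist v w := by
  have := norm2_add_le (fun p : I × S => u p.1 p.2 - v p.1 p.2)
    (fun p : I × S => v p.1 p.2 - w p.1 p.2)
  simpa [flagDist] using this

lemma flagDist_comm (u v : I → S → ℝ) : flagDist u v = flagDist v u := by
  unfold flagDist norm2
  congr 1
  exact Finset.sum_congr rfl fun p _ => by ring

lemma flagDist_sq (u v : I → S → ℝ) : flagDist u v ^ 2 = ∑ i, ∑ s, (u i s - v i s) ^ 2 := by
  rw [flagDist, norm2, Real.sq_sqrt (Finset.sum_nonneg fun _ _ => sq_nonneg _),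
    Fintype.sum_prod_type]

lemma le_one_of_stdSimplex (x : stdSimplex ℝ A) (a : A) : x a ≤ 1 :=
  (Finset.single_le_sum (fun b _ => x.2.1 b) (Finset.mem_univ a)).trans_eq x.2.2

lemma abs_le_one_of_stdSimplex (x : stdSimplex ℝ A) (a : A) : |x a| ≤ 1 :=
  abs_le.2 ⟨neg_one_lt_zero.le.trans (x.2.1 a), le_one_of_stdSimplex x a⟩

/-- Two mixed actions, one of which is a perturbation of the other. -/
lemma norm2_perturbation_sub_le [Nonempty I] {η : ℝ} (hη : 0 ≤ η) {x y : stdSimplex ℝ I}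
    (h : IsPerturbation η x y) : norm2 (fun i => y i - x i) ≤ η := by
  have h1 : (fun i => (y i : ℝ) - x i) = fun i => η * ((Fintype.card I : ℝ)⁻¹ - x i) := by
    ext i; rw [h i]; ring
  rw [h1, norm2_const_mul, abs_of_nonneg hη]
  refine mul_le_of_le_one_right hη (Real.sqrt_le_one.2 ?_)
  have hx : ∑ i, (x i : ℝ) = 1 := x.2.2
  have hc : (0 : ℝ) < Fintype.card I := by exact_mod_cast Fintype.card_pos
  -- The square of `x i` is bounded by `x i`, because `0 ≤ x i ≤ 1`.
  calc ∑ i, ((Fintype.card I : ℝ)⁻¹ - x i) ^ 2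
      ≤ ∑ i, ((Fintype.card I : ℝ)⁻¹ * (Fintype.card I : ℝ)⁻¹
          - 2 * (Fintype.card I : ℝ)⁻¹ * x i + x i) := Finset.sum_le_sum fun i _ => by
        have h2 := le_one_of_stdSimplex x i
        have h3 : 0 ≤ x i := x.2.1 i
        nlinarith
    _ = 1 - (Fintype.card I : ℝ)⁻¹ := by
        have h2 : ∑ i, 2 * (Fintype.card I : ℝ)⁻¹ * x i = 2 * (Fintype.card I : ℝ)⁻¹ := by
          rw [← Finset.mul_sum, hx, mul_one]
        rw [Finset.sum_add_distrib, Finset.sum_sub_distrib, h2, hx]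
        simp only [Finset.sum_const, Finset.card_univ, nsmul_eq_mul]
        field_simp
        ring
    _ ≤ 1 := by linarith [inv_pos.2 hc]

end Euclidean

/-! ### Averages over finite sets of stages -/

section Averages

lemma average_mem_stdSimplex {A : Type*} [Fintype A] {N : Finset ℕ} (hN : N.Nonempty)
    {a : ℕ → A → ℝ} (ha : ∀ m, a m ∈ stdSimplex ℝ A) : average N a ∈ stdSimplex ℝ A := by
  have hc : (N.card : ℝ) ≠ 0 := by exact_mod_cast hN.card_pos.ne'
  rw [average, Finset.smul_sum]
  refine (convex_stdSimplex ℝ A).sum_mem (fun _ _ => by positivity) ?_ fun m _ => ha m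
  rw [Finset.sum_const, nsmul_eq_mul, mul_inv_cancel₀ hc]

lemma average_apply {A E : Type*} [AddCommGroup E] [Module ℝ E] (N : Finset ℕ) (a : ℕ → A → E)
    (i : A) : average N a i = average N fun m => a m i := by
  simp [average]

lemma average_sub {E : Type*} [AddCommGroup E] [Module ℝ E] (N : Finset ℕ) (a b : ℕ → E) :
    (average N fun m => a m - b m) = average N a - average N b := by
  simp [average, smul_sub]

lemma average_const {N : Finset ℕ} (hN : N.Nonempty) (c : ℝ) : (average N fun _ => c) = c := by
  have hc : (N.card : ℝ) ≠ 0 := by exact_mod_cast hN.card_pos.ne'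
  simp [average, hc]

end Averages

/-! ### Frequencies and types used finitely often -/

section Plays

variable {L I S : Type*} [DecidableEq L] [Fintype S]

lemma exists_flag_vec_eq_averageFlag {w : ℕ → Stage L I S} {n : ℕ} {l : L}
    (h : (stagesOfType w n l).Nonempty) : ∃ ν : Flag I S, ν.vec = averageFlag w n l := by
  refine ⟨fun i => ⟨averageFlag w n l i, ?_⟩, rfl⟩
  rw [averageFlag, average_apply]
  exact average_mem_stdSimplex h fun m => ((w m).flag i).2

lemma averageAction_mem_stdSimplex [Fintype I] [DecidableEq I] {w : ℕ → Stage L I S} {n : ℕ} {l : L}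
    (h : (stagesOfType w n l).Nonempty) : averageAction w n l ∈ stdSimplex ℝ I :=
  average_mem_stdSimplex h fun m => single_mem_stdSimplex ℝ (w m).action

lemma stagesOfType_mono (w : ℕ → Stage L I S) (l : L) : Monotone fun n => stagesOfType w n l :=
  fun _ _ h => Finset.filter_subset_filter _ (Finset.range_mono h)

lemma frequency_nonneg (w : ℕ → Stage L I S) (n : ℕ) (l : L) : 0 ≤ frequency w n l := by
  unfold frequency; positivity

lemma frequency_le_one (w : ℕ → Stage L I S) (n : ℕ) (l : L) : frequency w n l ≤ 1 := by
  refine div_le_one_of_le₀ ?_ n.cast_nonneg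
  exact_mod_cast (Finset.card_filter_le _ _).trans (Finset.card_range n).le

/-- A quantity attached to the set of stages of type `l` is negligible once it is multiplied by the
frequency of the type, if there are finitely many such stages. -/
lemma tendsto_frequency_mul {w : ℕ → Stage L I S} {l : L}
    (h : ¬ Tendsto (fun n => (stagesOfType w n l).card) atTop atTop) (X : Finset ℕ → ℝ) :
    Tendsto (fun n => frequency w n l * X (stagesOfType w n l)) atTop (𝓝 0) := by
  have hmono : Monotone fun n => (stagesOfType w n l).card :=
    fun _ _ hnm => Finset.card_le_card (stagesOfType_mono w l hnm)
  obtain ⟨c, hc⟩ := (tendsto_atTop_of_monotone hmono).resolve_left h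
  have hev : ∀ᶠ n in atTop, (stagesOfType w n l).card = c := by
    rw [nhds_discrete] at hc
    exact tendsto_pure.1 hc
  obtain ⟨n₀, hn₀⟩ := eventually_atTop.1 hev
  -- Nested finite sets of equal cardinality coincide, so the set of stages itself is eventually
  -- constant.
  have hconst : ∀ n ≥ n₀, stagesOfType w n l = stagesOfType w n₀ l := fun n hn =>
    (Finset.eq_of_subset_of_card_le (stagesOfType_mono w l hn)
      (by rw [hn₀ n hn, hn₀ n₀ le_rfl])).symm
  have hlim := tendsto_const_div_atTop_nhds_zero_nat
    ((stagesOfType w n₀ l).card * X (stagesOfType w n₀ l))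
  refine hlim.congr' ?_
  filter_upwards [eventually_ge_atTop n₀] with n hn
  rw [frequency, hconst n hn]
  ring

lemma limsup_coe_le_zero {f : ℕ → ℝ} (h : ∀ ε > 0, ∀ᶠ n in atTop, f n ≤ ε) :
    limsup (fun n => (f n : EReal)) atTop ≤ 0 := by
  refine EReal.le_of_forall_lt_iff_le.1 fun ε hε => ?_
  have hε' : 0 < ε := by exact_mod_cast hε
  refine limsup_le_of_le (h := ?_)
  filter_upwards [h ε hε'] with n hn
  exact_mod_cast hn

/-- If a quantity attached to the stages of type `l` is asymptotically nonpositive when there are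
infinitely many of them, then its product with the frequency of the type always is. -/
lemma limsup_frequency_mul_le {w : ℕ → Stage L I S} {l : L} (X : Finset ℕ → ℝ)
    (h : Tendsto (fun n => (stagesOfType w n l).card) atTop atTop →
      ∀ ε > 0, ∀ᶠ n in atTop, X (stagesOfType w n l) ≤ ε) :
    limsup (fun n => ((frequency w n l * X (stagesOfType w n l) : ℝ) : EReal)) atTop ≤ 0 := by
  refine limsup_coe_le_zero fun ε hε => ?_
  by_cases hN : Tendsto (fun n => (stagesOfType w n l).card) atTop atTop
  · filter_upwards [h hN ε hε] with n hn
    calc _ ≤ frequency w n l * ε := mul_le_mul_of_nonneg_left hn (frequency_nonneg w n l)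
      _ ≤ ε := mul_le_of_le_one_left hε.le (frequency_le_one w n l)
  · exact ((tendsto_frequency_mul hN X).eventually_lt_const hε).mono fun n hn => hn.le

lemma regret_le [Fintype I] [Nonempty I] [DecidableEq I] {G : (I → ℝ) → (I → S → ℝ) → ℝ} {ε : ℝ} {w : ℕ → Stage L I S} {n : ℕ}
    {l : L} (h : IsBestResponse G ε (averageFlag w n l) (averageAction w n l)) :
    regret G w n l ≤ ε :=
  ciSup_le fun z => by linarith [h z]

end Plays

/-! ### Calibration on the estimates and internal consistency -/

section Calibration

variable {L I S : Type*} [Fintype I] [Fintype S]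

/-- The squared distance from `e` to `μ`, up to a term that does not depend on `μ`. -/
def score (μ e : I → S → ℝ) : ℝ := ∑ i, ∑ s, (μ i s ^ 2 - 2 * e i s * μ i s)

/-- The squares of `e` cancel, which makes the comparison affine in `e`. -/
lemma flagDist_sq_sub_flagDist_sq (e μ ν : I → S → ℝ) :
    flagDist e μ ^ 2 - flagDist e ν ^ 2 = score μ e - score ν e := by
  simp only [flagDist_sq, score, ← Finset.sum_sub_distrib]
  exact Finset.sum_congr rfl fun i _ => Finset.sum_congr rfl fun s _ => by ring

/-- The score is affine in its second argument. -/
lemma sum_mul_score {A : Type*} (T : Finset A) (p : A → ℝ) (hp : ∑ a ∈ T, p a = 1)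
    (μ : I → S → ℝ) (e : A → I → S → ℝ) :
    ∑ a ∈ T, p a * score μ (e a) = score μ (fun i s => ∑ a ∈ T, p a * e a i s) := by
  simp_rw [score, Finset.mul_sum]
  rw [Finset.sum_comm]
  refine Finset.sum_congr rfl fun i _ => ?_
  rw [Finset.sum_comm]
  refine Finset.sum_congr rfl fun s _ => ?_
  calc ∑ a ∈ T, p a * (μ i s ^ 2 - 2 * e a i s * μ i s)
      = (∑ a ∈ T, p a) * μ i s ^ 2 - ∑ a ∈ T, 2 * (p a * e a i s) * μ i s := by
        rw [Finset.sum_mul, ← Finset.sum_sub_distrib]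
        exact Finset.sum_congr rfl fun a _ => by ring
    _ = _ := by rw [hp, one_mul, Finset.sum_mul]

/-- This turns calibration, a statement on the average estimate, into a bound on sums of stage
payoffs. -/
lemma average_score {N : Finset ℕ} (hN : N.Nonempty) (μ : I → S → ℝ) (e : ℕ → I → S → ℝ) :
    (average N fun m => score μ (e m)) = score μ (average N e) := by
  have hc : (N.card : ℝ) ≠ 0 := by exact_mod_cast hN.card_pos.ne'
  rw [average, smul_eq_mul, Finset.mul_sum, sum_mul_score N _ (by simp [hc])]
  congr 1
  ext i s
  rw [average_apply, average_apply, average, smul_eq_mul, Finset.mul_sum]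

lemma sum_mul_flag (x : stdSimplex ℝ I) (ν : Flag I S) :
    ∑ a : I × S, (x a.1 : ℝ) * ν a.1 a.2 = 1 := by
  have hS : ∀ i, ∑ s, (ν i s : ℝ) = 1 := fun i => (ν i).2.2
  have hI : ∑ i, (x i : ℝ) = 1 := x.2.2
  simp only [Fintype.sum_prod_type, ← Finset.mul_sum, hS, mul_one, hI]

variable [DecidableEq I] [DecidableEq S]

/-- The estimate of a flag from the observation of the type, the action and the signal. -/
noncomputable def estimateOf (y : L → stdSimplex ℝ I) (a : L × I × S) : I → S → ℝ :=
  fun i s => if a.2.1 = i ∧ a.2.2 = s then (y a.1 a.2.1 : ℝ)⁻¹ else 0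

/-- The estimate is unbiased. -/
lemma sum_mul_estimateOf {y : L → stdSimplex ℝ I} {l : L} (hy : ∀ i, 0 < (y l i : ℝ))
    (ν : Flag I S) (i : I) (s : S) :
    ∑ a : I × S, ((y l a.1 : ℝ) * ν a.1 a.2) * estimateOf y (l, a) i s = ν i s := by
  rw [Finset.sum_eq_single (i, s)]
  · simp only [estimateOf, and_self, if_true]
    field_simp [(hy i).ne']
  · intro a _ ha
    have : ¬ (a.1 = i ∧ a.2 = s) := fun h => ha (Prod.ext h.1 h.2)
    simp [estimateOf, this]
  · simp

/-- The payoff of type `l` against the point `μ k` of the grid. -/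
noncomputable def calibrationScore (μ : L → Flag I S) (y : L → stdSimplex ℝ I) (l k : L) (a : L × I × S) : ℝ :=
  score (μ l).vec (estimateOf y a) - score (μ k).vec (estimateOf y a)

variable [DecidableEq L]

/-- The weighted positive part of the past payoffs of type `l` against the point `μ k`. -/
noncomputable def calibrationRate (μ : L → Flag I S) (y : L → stdSimplex ℝ I) {n : ℕ}
    (o : Fin n → L × I × S) (l k : L) : ℝ :=
  stepWeight (typeCount Prod.fst o l + 1) *
    max (typeSum Prod.fst (calibrationScore μ y l k) o l) 0

lemma calibrationRate_nonneg (μ : L → Flag I S) (y : L → stdSimplex ℝ I) {n : ℕ}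
    (o : Fin n → L × I × S) (l k : L) : 0 ≤ calibrationRate μ y o l k :=
  mul_nonneg (stepWeight_nonneg _) (le_max_right _ _)

variable [Fintype L]

/-- The law of the next type is invariant for the rates given by the past payoffs. -/
noncomputable def calibratedStrategy [Nonempty L] (μ : L → Flag I S) (y : L → stdSimplex ℝ I) :
    StrategyOne L I S :=
  fun _ o => (exists_invariant_probability (calibrationRate μ y o)
    (calibrationRate_nonneg μ y o)).choose

lemma calibratedStrategy_invariant [Nonempty L] (μ : L → Flag I S) (y : L → stdSimplex ℝ I) (n : ℕ)
    (o : Fin n → L × I × S) (l : L) :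
    calibratedStrategy μ y n o l * ∑ k, calibrationRate μ y o l k =
      ∑ k, calibratedStrategy μ y n o k * calibrationRate μ y o k l :=
  (exists_invariant_probability (calibrationRate μ y o) (calibrationRate_nonneg μ y o)).choose_spec l

variable [MeasurableSpace L] [MeasurableSpace I] [MeasurableSpace S]
  [DiscreteMeasurableSpace L] [DiscreteMeasurableSpace I] [DiscreteMeasurableSpace S]

/-- On the stages of a type that is used infinitely often, the average estimate is asymptotically
at least as close to the point of the grid of this type as to the other points. -/
theorem ae_calibrated [Nonempty L] (μ : L → Flag I S) {y : L → stdSimplex ℝ I}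
    (hy : ∀ l i, 0 < (y l i : ℝ)) (τ : StrategyTwo L I S) :
    ∀ᵐ w ∂(playLaw (calibratedStrategy μ y) y τ), ∀ l k,
      Tendsto (fun n => (stagesOfType w n l).card) atTop atTop → ∀ ε > 0, ∀ᶠ n in atTop,
        flagDist (averageEstimate y w n l) (μ l).vec ^ 2
          - flagDist (averageEstimate y w n l) (μ k).vec ^ 2 ≤ ε := by
  obtain ⟨B, hB⟩ : BddAbove (Set.range fun p : (L × L) × L × I × S =>
    |calibrationScore μ y p.1.1 p.1.2 p.2|) := Set.finite_range _ |>.bddAbove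
  have key := ae_typeSum_le (J := L × L) (σ := calibratedStrategy μ y) (x := y) (τ := τ) Prod.fst
    (u := fun j v => calibrationScore μ y j.1 j.2 v.2)
    (fun j => (measurable_of_finite (calibrationScore μ y j.1 j.2)).comp measurable_snd)
    (B := B) (fun j v => hB ⟨(j, v.2), rfl⟩)
    (fun n h ν => by
      refine le_of_eq ?_
      set q : L → ℝ := fun l => calibratedStrategy μ y n (observed h) l with hq
      set g : L → L → ℝ := calibrationRate μ y (observed h) with hg
      have hinv : ∀ l, q l * ∑ k, g l k = ∑ k, q k * g k l :=
        calibratedStrategy_invariant μ y n (observed h)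
      -- An unbiased estimate and an affine score: the mean payoff is the same comparison at the
      -- true flag.
      have hmean : ∀ l k, ∑ a : I × S, (y l a.1 : ℝ) * ν a.1 a.2 * calibrationScore μ y l k (l, a) =
          score (μ l).vec ν.vec - score (μ k).vec ν.vec := fun l k => by
        simp only [calibrationScore, mul_sub, Finset.sum_sub_distrib,
          sum_mul_score _ _ (sum_mul_flag (y l) ν), sum_mul_estimateOf (hy l) ν]
        rfl
      calc _ = ∑ l, ∑ a : I × S, ∑ k, q l * (y l a.1) * ν a.1 a.2 *
            (g l k * calibrationScore μ y l k (l, a)) := by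
            rw [Fintype.sum_prod_type]
            refine Finset.sum_congr rfl fun l _ => Finset.sum_congr rfl fun a _ => ?_
            rw [Fintype.sum_prod_type, Finset.sum_eq_single l
              (fun l' _ hl' => by simp [hl'.symm]) (by simp), Finset.mul_sum]
            refine Finset.sum_congr rfl fun k _ => ?_
            simp only [if_true]
            -- The payoffs ignore the flags, so the counts and sums over the full history are by
            -- definition those over the observed one.
            rfl
        _ = ∑ l, ∑ k, q l * g l k * (score (μ l).vec ν.vec - score (μ k).vec ν.vec) := by
            refine Finset.sum_congr rfl fun l _ => ?_
            rw [Finset.sum_comm]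
            refine Finset.sum_congr rfl fun k _ => ?_
            rw [← hmean l k, Finset.mul_sum]
            exact Finset.sum_congr rfl fun a _ => by ring
        _ = ∑ l, (q l * ∑ k, g l k) * score (μ l).vec ν.vec -
              ∑ l, (∑ k, q k * g k l) * score (μ l).vec ν.vec := by
            simp only [mul_sub, Finset.sum_sub_distrib, Finset.sum_mul, Finset.mul_sum]
            congr 1
            rw [Finset.sum_comm]
        _ = 0 := by simp [hinv])
  filter_upwards [key] with w hw l k hN ε hε
  filter_upwards [hw (l, k) hN ε hε, hN.eventually_ge_atTop 1] with n h1 h2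
  have h3 : (0 : ℝ) < (stagesOfType w n l).card := by exact_mod_cast h2
  rw [flagDist_sq_sub_flagDist_sq, averageEstimate, ← average_score (Finset.card_pos.1 h2),
    ← average_score (Finset.card_pos.1 h2), ← average_sub, average, smul_eq_mul, inv_mul_le_iff₀ h3,
    mul_comm]
  exact h1

/-- The average estimate of the flags is consistent on the stages of a given type. -/
theorem ae_flagDist_averageEstimate (σ : StrategyOne L I S) {y : L → stdSimplex ℝ I}
    (hy : ∀ l i, 0 < (y l i : ℝ)) (τ : StrategyTwo L I S) :
    ∀ᵐ w ∂(playLaw σ y τ), ∀ l, Tendsto (fun n => (stagesOfType w n l).card) atTop atTop →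
      Tendsto (fun n => flagDist (averageEstimate y w n l) (averageFlag w n l)) atTop (𝓝 0) := by
  obtain ⟨B, hB⟩ : BddAbove (Set.range fun p : (I × S) × L × I × S =>
    |estimateOf y p.2 p.1.1 p.1.2|) := Set.finite_range _ |>.bddAbove
  have key : ∀ᵐ w ∂(playLaw σ y τ), ∀ (l : L) (p : I × S),
      Tendsto (fun n => (stagesOfType w n l).card) atTop atTop →
        Tendsto (fun n => average (stagesOfType w n l) fun m =>
          estimate y (w m) p.1 p.2 - (w m).flag.vec p.1 p.2) atTop (𝓝 0) := by
    refine ae_all_iff.2 fun l => ae_all_iff.2 fun p => ?_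
    refine ae_average_tendsto_zero l
      (u := fun v : Stage L I S => estimate y v p.1 p.2 - v.flag.vec p.1 p.2) ?_ (B := B + 1) ?_ ?_
    · refine Measurable.sub ?_ ?_
      · exact (measurable_of_finite fun a : L × I × S => estimateOf y a p.1 p.2).comp measurable_snd
      · exact (measurable_pi_apply p.2).comp
          (measurable_subtype_coe.comp ((measurable_pi_apply p.1).comp measurable_fst))
    · intro v
      exact (abs_sub _ _).trans (add_le_add (hB ⟨(p, v.2), rfl⟩) 
        (abs_le_one_of_stdSimplex (v.flag p.1) p.2))
    · intro ν
      rw [← Fintype.sum_prod_type' fun i s => (y l i : ℝ) * ν i s *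
        (estimate y ((ν, l, i, s) : Stage L I S) p.1 p.2 -
          (Stage.flag ((ν, l, i, s) : Stage L I S)).vec p.1 p.2)]
      have h1 := sum_mul_estimateOf (hy l) ν p.1 p.2
      have h2 := sum_mul_flag (y l) ν
      simp only [mul_sub, Finset.sum_sub_distrib]
      refine sub_eq_zero.2 (h1.trans ?_)
      change _ = ∑ a : I × S, (y l a.1 : ℝ) * ν a.1 a.2 * ν p.1 p.2
      rw [← Finset.sum_mul, h2, one_mul]
  filter_upwards [key] with w hw l hN
  refine tendsto_norm2_zero fun p => (hw l p hN).congr fun n => ?_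
  rw [average_sub, averageEstimate, averageFlag, average_apply, average_apply, average_apply,
    average_apply]

omit [DecidableEq S] in
/-- On the stages of a given type, the empirical distribution of the actions converges. -/
theorem ae_norm2_averageAction (σ : StrategyOne L I S) (y : L → stdSimplex ℝ I)
    (τ : StrategyTwo L I S) :
    ∀ᵐ w ∂(playLaw σ y τ), ∀ l, Tendsto (fun n => (stagesOfType w n l).card) atTop atTop →
      Tendsto (fun n => norm2 fun i => averageAction w n l i - y l i) atTop (𝓝 0) := by
  have key : ∀ᵐ w ∂(playLaw σ y τ), ∀ (l : L) (i : I),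
      Tendsto (fun n => (stagesOfType w n l).card) atTop atTop →
        Tendsto (fun n => average (stagesOfType w n l) fun m =>
          (Pi.single (w m).action 1 : I → ℝ) i - y l i) atTop (𝓝 0) := by
    refine ae_all_iff.2 fun l => ae_all_iff.2 fun i => ?_
    refine ae_average_tendsto_zero l
      (u := fun v : Stage L I S => (Pi.single v.action 1 : I → ℝ) i - y l i) ?_ (B := 1 + 1) ?_ ?_
    · refine Measurable.sub_const ?_ _
      exact (measurable_of_finite fun a : L × I × S => (Pi.single a.2.1 1 : I → ℝ) i).comp
        measurable_snd
    · intro v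
      exact (abs_sub _ _).trans (add_le_add
        (abs_le_one_of_stdSimplex ⟨_, single_mem_stdSimplex ℝ v.action⟩ i)
        (abs_le_one_of_stdSimplex _ i))
    · intro ν
      have hS : ∀ i, ∑ s, (ν i s : ℝ) = 1 := fun i => (ν i).2.2
      have hI : ∑ i, (y l i : ℝ) = 1 := (y l).2.2
      calc _ = ∑ k, y l k * (∑ s, ν k s) * ((Pi.single k 1 : I → ℝ) i - y l i) := by
            simp_rw [Finset.mul_sum, Finset.sum_mul]
            rfl
        _ = 0 := by
            simp [hS, mul_sub, Finset.sum_sub_distrib, ← Finset.sum_mul, hI, Pi.single_apply]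
  filter_upwards [key] with w hw l hN
  refine tendsto_norm2_zero fun i => (hw l i hN).congr' ?_
  filter_upwards [hN.eventually_ge_atTop 1] with n hn
  rw [average_sub, average_const (Finset.card_pos.1 hn), averageAction, average_apply]

theorem calibratedOnEstimates_calibratedStrategy [Nonempty L] (μ : L → Flag I S)
    {y : L → stdSimplex ℝ I} (hy : ∀ l i, 0 < (y l i : ℝ)) :
    CalibratedOnEstimates μ y (calibratedStrategy μ y) := by
  intro τ
  filter_upwards [ae_calibrated μ hy τ] with w hw l k
  -- The quantity is written as a function of the set of stages, which is what settles types used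
  -- finitely often.
  exact limsup_frequency_mul_le (w := w) (l := l) (fun N =>
    flagDist (average N fun m => estimate y (w m)) (μ l).vec ^ 2 -
      flagDist (average N fun m => estimate y (w m)) (μ k).vec ^ 2) (hw l k)

theorem internallyConsistent_calibratedStrategy [Nonempty I] [Nonempty L]
    {G : (I → ℝ) → (I → S → ℝ) → ℝ} {ε : ℝ} {μ : L → Flag I S} {x y : L → stdSimplex ℝ I}
    {η δ : ℝ} (hreg : IsRegularFamily G ε μ x η δ) (hxy : ∀ l, IsPerturbation η (x l) (y l))
    (hy : ∀ l i, 0 < (y l i : ℝ)) :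
    InternallyConsistent G ε y (calibratedStrategy μ y) := by
  intro τ
  filter_upwards [ae_calibrated μ hy τ, ae_flagDist_averageEstimate _ hy τ,
    ae_norm2_averageAction _ y τ] with w h1 h2 h3 l
  refine limsup_frequency_mul_le (w := w) (l := l) (fun N =>
    (⨆ z : stdSimplex ℝ I, (G z (average N fun m => (w m).flag.vec) -
      G (average N fun m => Pi.single (w m).action 1) (average N fun m => (w m).flag.vec))) - ε)
    fun hN θ hθ => ?_
  have hδ := hreg.delta_pos
  have hη := hreg.eta_pos
  -- With errors `δ²/16` here and `δ/4` for the estimate, `‖e - μ k‖ ≤ 5δ/4` yields `‖e - μ l‖² ≤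
  -- 26δ²/16 ≤ (3δ/2)²`, and the average flag is within `7δ/4` of `μ l`.
  have h4 : ∀ᶠ n in atTop, ∀ k, flagDist (averageEstimate y w n l) (μ l).vec ^ 2
      - flagDist (averageEstimate y w n l) (μ k).vec ^ 2 ≤ δ ^ 2 / 16 :=
    eventually_all.2 fun k => h1 l k hN _ (by positivity)
  filter_upwards [h4, (h2 l hN).eventually_lt_const (show 0 < δ / 4 by positivity),
    (h3 l hN).eventually_lt_const hη, hN.eventually_ge_atTop 1] with n h5 h6 h7 h8
  have hne := Finset.card_pos.1 h8
  suffices regret G w n l ≤ ε from (sub_nonpos.2 this).trans hθ.le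
  obtain ⟨ν, hν⟩ := exists_flag_vec_eq_averageFlag hne
  refine regret_le ?_
  rw [← hν]
  refine hreg.response l ⟨averageAction w n l, averageAction_mem_stdSimplex hne⟩ ν ?_ ?_
  · have h9 := norm2_add_le (fun i => averageAction w n l i - y l i) (fun i => y l i - x l i)
    have h10 := norm2_perturbation_sub_le hη.le (hxy l)
    simp only [sub_add_sub_cancel] at h9
    change norm2 (fun i => averageAction w n l i - x l i) ≤ 2 * η
    linarith
  · obtain ⟨k, hk⟩ := hreg.cover ν
    rw [hν] at hk ⊢
    set e := averageEstimate y w n l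
    set a := averageFlag w n l
    have h11 := flagDist_triangle e a (μ k).vec
    have h12 := flagDist_triangle a e (μ l).vec
    rw [flagDist_comm a e] at h12
    have h13 : flagDist e (μ l).vec ≤ 3 / 2 * δ := by
      refine abs_le_of_sq_le_sq' ?_ (by positivity) |>.2
      have h14 : flagDist e (μ k).vec ^ 2 ≤ (5 / 4 * δ) ^ 2 :=
        pow_le_pow_left₀ (flagDist_nonneg _ _) (by linarith) 2
      nlinarith [h5 k]
    linarith

end Calibration

/-! ### Choice of the radius and of the perturbed actions -/

/-- A regular family remains regular when the radius of the balls of mixed actions shrinks. -/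
lemma IsRegularFamily.mono_eta {L I S : Type*} [Fintype I] [Fintype S]
    {G : (I → ℝ) → (I → S → ℝ) → ℝ} {ε : ℝ} {μ : L → Flag I S} {x : L → stdSimplex ℝ I} {η η' δ : ℝ}
    (h : IsRegularFamily G ε μ x η δ) (h0 : 0 < η') (hle : η' ≤ η) :
    IsRegularFamily G ε μ x η' δ where
  eta_pos := h0
  delta_pos := h.delta_pos
  cover := h.cover
  response l x' ν hx hν := h.response l x' ν (hx.trans (by linarith)) hν

/-- The uniform part gives every action a positive probability, as unbiased estimation by inverse
probabilities requires; `η ≤ 1` keeps the combination convex. -/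
lemma exists_isPerturbation {I : Type*} [Fintype I] [Nonempty I] {η : ℝ} (h0 : 0 < η) (h1 : η ≤ 1)
    (x : stdSimplex ℝ I) : ∃ y : stdSimplex ℝ I, IsPerturbation η x y ∧ ∀ i, 0 < (y i : ℝ) := by
  have hc : (0 : ℝ) < Fintype.card I := by exact_mod_cast Fintype.card_pos
  have hpos : ∀ i, 0 < (1 - η) * x i + η * (Fintype.card I : ℝ)⁻¹ := fun i =>
    add_pos_of_nonneg_of_pos (mul_nonneg (by linarith) (x.2.1 i)) (by positivity)
  refine ⟨⟨fun i => (1 - η) * x i + η * (Fintype.card I : ℝ)⁻¹, fun i => (hpos i).le, ?_⟩,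
    fun i => rfl, hpos⟩
  have hx : ∑ i, (x i : ℝ) = 1 := x.2.2
  rw [Finset.sum_add_distrib, ← Finset.mul_sum, hx]
  simp only [Finset.sum_const, Finset.card_univ, nsmul_eq_mul]
  field_simp
  ring

end PartialMonitoring

theorem theorem2p6 {I S : Type*} [Fintype I] [Fintype S] [Nonempty I] [Nonempty S]
    [DecidableEq I] [DecidableEq S] [MeasurableSpace I] [MeasurableSpace S]
    [DiscreteMeasurableSpace I] [DiscreteMeasurableSpace S]
    (G : (I → ℝ) → (I → S → ℝ) → ℝ) (hG : RegularEvaluation G) (ε : ℝ) (hε : 0 < ε) :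
    ∃ (K : ℕ) (μ : Fin K → Flag I S) (x : Fin K → stdSimplex ℝ I) (η δ : ℝ),
      IsRegularFamily G ε μ x η δ ∧ η ≤ 1 ∧
      ∃ (y : Fin K → stdSimplex ℝ I) (σ : StrategyOne (Fin K) I S),
        (∀ l, IsPerturbation η (x l) (y l)) ∧
        CalibratedOnEstimates μ y σ ∧
        InternallyConsistent G ε y σ := by
  obtain ⟨K, μ, x, η, δ, hreg⟩ := hG ε hε
  -- Regularity may come with a radius above 1, for which the perturbation need not be a
  -- probability.
  have hmin : 0 < min η 1 := lt_min hreg.eta_pos one_pos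
  have hreg' := hreg.mono_eta hmin (min_le_left η 1)
  choose y hxy hy using fun l => exists_isPerturbation hmin (min_le_right η 1) (x l)
  -- A flag exists and must be covered, so the grid is not empty and a law on the types can be
  -- chosen.
  have : Nonempty (Flag I S) := inferInstance
  obtain ⟨ν⟩ := this
  have : Nonempty (Fin K) := ⟨(hreg.cover ν).choose⟩
  exact ⟨K, μ, x, min η 1, δ, hreg', min_le_right η 1, y, calibratedStrategy μ y, hxy,
    calibratedOnEstimates_calibratedStrategy μ hy,
    internallyConsistent_calibratedStrategy hreg' hxy hy⟩
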